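/- Let $2\le a<b<c$ be pairwise coprime integers, and let $g(a,b,c)$ be the Frobenius number, i.e. the largest integer that is not a linear combination of $a,b,c$ with non-negative integer coefficients. Put $k=\lfloor c/b\rfloor$, let $\ell\in\{0,\dots,a-1\}$ be the residue of $cb^{-1}$ modulo $a$, and assume $\ell>k$. Define \[ \bar q=\Big\lfloor\frac a\ell\Big\rfloor,\quad \bar r=a-\bar q\,\ell,\quad \bar A=b(\ell-\bar r)-c(\bar q+1),\quad \bar B=b\bar r+c\bar q,\quad \bar u=\bar r \bmod (\ell-\bar r), \] \[ \bar\mu=\min\Big\{i\in\mathbb Z_{\ge 0}\ \Big|\ \Big\lfloor\frac{(i+1)\bar B}{\bar A}\Big\rfloor\ne\Big\lfloor\frac{(i+1)\bar r}{\ell-\bar r}\Big\rfloor\Big\}. \] For an integer $z\ge 0$ let $\mathbf m(z)$ be the least positive integer that is congruent to $z$ modulo $a$ and of the form $bn_1+cn_2$ with integers $n_1,n_2\ge 0$, and let \[ \bar{\mathscr X}=\{x\in\{0,1,\dots,\ell-\bar r\}\mid \mathbf m(bx)\equiv 0 \bmod c\}. \] For $i\ge 0$ put \[ x_i=(\ell-\bar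 r)\Big(\Big\lfloor\frac{\bar r i}{\ell-\bar r}\Big\rfloor+1\Big)-\bar r i,\qquad y_i=(\bar q+1)\Big(\Big\lfloor\frac{\bar r i}{\ell-\bar r}\Big\rfloor+1\Big)+\bar q\, i . \] Suppose that $\bar u\neq 0$ and $\bar\mu>\lfloor(\ell-\bar r)/\bar u\rfloor$. Then $\bar{\mathscr X}=\{x_i\mid 0\le i\le\bar\mu\}$. Moreover, there is $m\in\{0,\dots,\bar\mu\}$ with $x_m=\min\bar{\mathscr X}$, and for any such $m$ we have $m\ge 1$, there is a largest $w\in\{0,\dots,\bar\mu\}$ such that $x_w+x_m\in\bar{\mathscr X}$, and \[ g(a,b,c)+a=\max\big\{b(x_m-1)+cy_w,\ b(x_{m-1}-x_{\bar\mu}-1)+cy_{\bar\mu}\big\}+c\Big((\bar q+1)\Big\lfloor\frac{\ell-1}{\ell-\bar r}\Big\rfloor-2\Big). \] -/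

import Mathlib

/-- `k = ⌊c / b⌋`. -/
def kVal (b c : ℕ) : ℕ := c / b

/-- `ℓ ∈ {0, …, a - 1}` is the residue of `c b⁻¹` modulo `a`. -/
def ellVal (a b c : ℕ) : ℕ := ((c : ZMod a) * (b : ZMod a)⁻¹).val

/-- `q̄ = ⌊a / ℓ⌋`. -/
def qBar (a b c : ℕ) : ℕ := a / ellVal a b c

/-- `r̄ = a - q̄ ℓ` (the subtraction is exact). -/
def rBar (a b c : ℕ) : ℕ := a - qBar a b c * ellVal a b c

/-- `ℓ - r̄` (the subtraction is exact for `0 < ℓ`, see `rBar_lt_ellVal`). -/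
def dBar (a b c : ℕ) : ℕ := ellVal a b c - rBar a b c

/-- `ū = r̄ mod (ℓ - r̄)`. -/
def uBar (a b c : ℕ) : ℕ := rBar a b c % dBar a b c

/-- `Ā = b (ℓ - r̄) - c (q̄ + 1)`. -/
def ABar (a b c : ℕ) : ℤ := (b : ℤ) * dBar a b c - c * (qBar a b c + 1)

/-- `B̄ = b r̄ + c q̄`. -/
def BBar (a b c : ℕ) : ℤ := (b : ℤ) * rBar a b c + c * qBar a b c

/-- `μ̄ = min {i ≥ 0 | ⌊(i + 1) B̄ / Ā⌋ ≠ ⌊(i + 1) r̄ / (ℓ - r̄)⌋}`. -/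
noncomputable def muBar (a b c : ℕ) : ℕ :=
  sInf {i : ℕ | ⌊((i : ℚ) + 1) * (BBar a b c : ℚ) / (ABar a b c : ℚ)⌋ ≠
    ⌊((i : ℚ) + 1) * (rBar a b c : ℚ) / (dBar a b c : ℚ)⌋}

/-- `𝐦(x)`: the least positive integer congruent to `x` modulo `a` that is of the form
`b n₁ + c n₂` with non-negative integers `n₁`, `n₂`. -/
noncomputable def mMin (a b c x : ℕ) : ℕ :=
  sInf {z : ℕ | 0 < z ∧ (∃ n₁ n₂ : ℕ, z = b * n₁ + c * n₂) ∧ z ≡ x [MOD a]}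

/-- `𝒳̄ = {x ∈ {0, …, ℓ - r̄} | 𝐦(b x) ≡ 0 mod c}`. -/
def XBar (a b c : ℕ) : Set ℕ :=
  {x : ℕ | x ≤ dBar a b c ∧ mMin a b c (b * x) ≡ 0 [MOD c]}

/-- `x_i = (ℓ - r̄) (⌊r̄ i / (ℓ - r̄)⌋ + 1) - r̄ i` (the subtraction is exact for `0 < ℓ`, see
`xSeq_add`). -/
def xSeq (a b c i : ℕ) : ℕ :=
  dBar a b c * (rBar a b c * i / dBar a b c + 1) - rBar a b c * i

/-- `y_i = (q̄ + 1) (⌊r̄ i / (ℓ - r̄)⌋ + 1) + q̄ i`. -/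
def ySeq (a b c i : ℕ) : ℕ :=
  (qBar a b c + 1) * (rBar a b c * i / dBar a b c + 1) + qBar a b c * i

theorem rBar_add (a b c : ℕ) : rBar a b c + qBar a b c * ellVal a b c = a :=
  Nat.sub_add_cancel (Nat.div_mul_le_self a (ellVal a b c))

theorem rBar_lt_ellVal (a b c : ℕ) (h : 0 < ellVal a b c) : rBar a b c < ellVal a b c := by
  have h1 := Nat.div_add_mod a (ellVal a b c)
  have h2 := Nat.mod_lt a h
  have h3 := rBar_add a b c
  unfold qBar at h3
  rw [mul_comm] at h3
  omega

theorem xSeq_add (a b c i : ℕ) (h : 0 < ellVal a b c) :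
    xSeq a b c i + rBar a b c * i = dBar a b c * (rBar a b c * i / dBar a b c + 1) := by
  have hd : 0 < dBar a b c := Nat.sub_pos_of_lt (rBar_lt_ellVal a b c h)
  exact Nat.sub_add_cancel (Nat.lt_mul_div_succ _ hd).le

/-! Since `c ≡ l b` modulo `a`, one has `b x ≡ c y` exactly on the lattice `a ∣ x - l y`. Its points
in the strip `0 < x ≤ d` are the `(x_i, y_i)`, `i ∈ ℤ`, with `y_i` strictly increasing; adding or
subtracting indices adds or subtracts points while the strip is not left (`cut_add`, `cut_sub`). The
number `N = μ̄` is the last index up to which every `b x_i - c y_i` is positive. Subtracting points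
then shows which classes have a multiple of `c` as least value, and this gives `𝒳̄`.

The number `g + a` is the largest of the least values `b n₁ + c n₂` of the classes modulo `a`. The
vectors `(-x_m, y_m)`, `(x_{N+1}, -y_{N+1})` and their sum preserve the class and lower the value,
so they push every pair into an L-shape (`exists_inShape`). An empty rectangle makes its points
pairwise incongruent (`inShape_inj`), and the maximum sits at an outer corner. The condition on `ū`
forces `x_m < ū`, whence `x_{N+1} = x_N - ū`, `x_{m-1} = x_m + ū` and `w = N - m`, which turns the
corners into the stated formula. -/

/-! ### Lattice points in the strip -/

/-- Integer version of `xSeq`: the representative of `-r i` modulo `d` in `{1, …, d}`. -/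
def cutX (d r i : ℤ) : ℤ := d * (r * i / d + 1) - r * i

/-- Integer version of `ySeq`. -/
def cutY (q d r i : ℤ) : ℤ := (q + 1) * (r * i / d + 1) + q * i

/-- The arithmetic data attached to a triple `a < b < c`, over the integers. -/
structure TripleData (a b c l q r d : ℤ) : Prop where
  d_pos : 0 < d
  r_pos : 0 < r
  q_pos : 1 ≤ q
  l_eq : l = d + r
  a_eq : a = q * l + r
  cop : IsCoprime d r
  a_lt_b : a < b
  b_lt_c : b < c
  cop_ab : IsCoprime a b
  cop_cb : IsCoprime c b
  dvd : a ∣ c - l * b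

theorem cutX_pos {d : ℤ} (r i : ℤ) (hd : 0 < d) : 0 < cutX d r i := by
  unfold cutX
  have := Int.emod_lt_of_pos (r * i) hd
  have := Int.mul_ediv_add_emod (r * i) d
  linarith

theorem cutX_le {d : ℤ} (r i : ℤ) (hd : 0 < d) : cutX d r i ≤ d := by
  unfold cutX
  have := Int.emod_nonneg (r * i) hd.ne'
  have := Int.mul_ediv_add_emod (r * i) d
  linarith

theorem ediv_eq_of_cut {d r i α : ℤ} (hd : 0 < d) (h0 : 0 < d * α - r * i)
    (h1 : d * α - r * i ≤ d) : r * i / d + 1 = α := by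
  have h : r * i / d = α - 1 := by
    rw [Int.ediv_eq_iff_of_pos hd]
    constructor <;> nlinarith
  omega

theorem cut_add {q d r i j : ℤ} (hd : 0 < d) (h : cutX d r i + cutX d r j ≤ d) :
    cutX d r (i + j) = cutX d r i + cutX d r j ∧
      cutY q d r (i + j) = cutY q d r i + cutY q d r j := by
  have hi := cutX_pos r i hd
  have hj := cutX_pos r j hd
  unfold cutX cutY at *
  have e : r * (i + j) / d + 1 = (r * i / d + 1) + (r * j / d + 1) := by
    apply ediv_eq_of_cut hd <;> linarith
  rw [e]
  constructor <;> ring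

theorem cut_sub {q d r i j : ℤ} (hd : 0 < d) (h : cutX d r j < cutX d r i) :
    cutX d r (i - j) = cutX d r i - cutX d r j ∧
      cutY q d r (i - j) = cutY q d r i - cutY q d r j := by
  have hi := cutX_le r i hd
  have hj := cutX_pos r j hd
  unfold cutX cutY at *
  have e : r * (i - j) / d + 1 = (r * i / d + 1) - (r * j / d + 1) := by
    apply ediv_eq_of_cut hd <;> linarith
  rw [e]
  constructor <;> ring

theorem cut_zero {q d r : ℤ} : cutX d r 0 = d ∧ cutY q d r 0 = q + 1 := by
  simp [cutX, cutY]

namespace TripleData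

variable {a b c l q r d : ℤ}

theorem l_pos (T : TripleData a b c l q r d) : 0 < l := by
  have := T.d_pos; have := T.r_pos; have := T.l_eq; omega

theorem l_lt_a (T : TripleData a b c l q r d) : l < a := by
  have := T.q_pos; have := T.r_pos; have := T.a_eq; have := T.l_pos; nlinarith

theorem d_lt_l (T : TripleData a b c l q r d) : d < l := by
  have := T.r_pos; have := T.l_eq; omega

theorem a_pos (T : TripleData a b c l q r d) : 0 < a := T.l_pos.trans T.l_lt_a

theorem b_pos (T : TripleData a b c l q r d) : 0 < b := T.a_pos.trans T.a_lt_b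

theorem c_pos (T : TripleData a b c l q r d) : 0 < c := T.b_pos.trans T.b_lt_c

theorem cutY_strictMono (T : TripleData a b c l q r d) : StrictMono (cutY q d r) := by
  intro i j hij
  have hq := T.q_pos
  have h : r * i / d ≤ r * j / d :=
    Int.ediv_le_ediv T.d_pos (mul_le_mul_of_nonneg_left hij.le T.r_pos.le)
  unfold cutY
  nlinarith

theorem cutY_neg (T : TripleData a b c l q r d) {i : ℤ} (hi : i < 0) : cutY q d r i < 0 := by
  have hq := T.q_pos
  have h : r * i / d < 0 := Int.ediv_neg_of_neg_of_pos (by nlinarith [T.r_pos]) T.d_pos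
  unfold cutY
  nlinarith

theorem cut_shift (T : TripleData a b c l q r d) (i t : ℤ) :
    cutX d r (i + d * t) = cutX d r i ∧ cutY q d r (i + d * t) = cutY q d r i + a * t := by
  have e : r * (i + d * t) / d = r * i / d + r * t := by
    rw [show r * (i + d * t) = r * i + d * (r * t) by ring, Int.add_mul_ediv_left _ _ T.d_pos.ne']
  unfold cutX cutY
  rw [e, T.a_eq, T.l_eq]
  constructor <;> ring

theorem shift_of_cutX_eq (T : TripleData a b c l q r d) {i j : ℤ}
    (h : cutX d r i = cutX d r j) : ∃ t, i = j + d * t := by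
  unfold cutX at h
  have h1 : d ∣ r * (i - j) := ⟨r * i / d - r * j / d, by linarith⟩
  obtain ⟨t, ht⟩ := T.cop.dvd_of_dvd_mul_left h1
  exact ⟨t, by linarith⟩

theorem dvd_cut (T : TripleData a b c l q r d) (i : ℤ) :
    a ∣ cutX d r i - l * cutY q d r i := by
  refine ⟨-(r * i / d + 1) - i, ?_⟩
  unfold cutX cutY
  rw [T.a_eq, T.l_eq]
  ring

/-- Lattice points in the strip `0 < x ≤ d` are exactly the pairs `(x_i, y_i)`. -/
theorem exists_cut (T : TripleData a b c l q r d) {x y : ℤ} (h : a ∣ x - l * y)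
    (h0 : 0 < x) (h1 : x ≤ d) : ∃ i, x = cutX d r i ∧ y = cutY q d r i := by
  obtain ⟨t, ht⟩ := h
  -- Substitute `a = q d + (q + 1) r` and `l = d + r` into `x = l y + a t` and collect the
  -- coefficients of `d` and `r`.
  have hx : x = d * (q * t + y) - r * (-(q + 1) * t - y) := by
    have := T.a_eq
    have := T.l_eq
    subst_vars
    linear_combination ht
  have e := ediv_eq_of_cut T.d_pos (hx ▸ h0) (hx ▸ h1)
  refine ⟨-(q + 1) * t - y, ?_, ?_⟩
  · unfold cutX
    rw [e, ← hx]
  · unfold cutY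
    rw [e]
    ring

theorem exists_cut_nonneg (T : TripleData a b c l q r d) {x y : ℤ} (h : a ∣ x - l * y)
    (h0 : 0 < x) (h1 : x ≤ d) (hy : 0 ≤ y) :
    ∃ i, 0 ≤ i ∧ x = cutX d r i ∧ y = cutY q d r i := by
  obtain ⟨i, hx, hyi⟩ := T.exists_cut h h0 h1
  refine ⟨i, ?_, hx, hyi⟩
  by_contra! hi
  have := T.cutY_neg hi
  omega

/-- No ties: equality would give `c ∣ x_i`, although `0 < x_i ≤ d < c`. -/
theorem value_ne (T : TripleData a b c l q r d) (i : ℤ) :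
    b * cutX d r i ≠ c * cutY q d r i := by
  intro h
  have h1 : c ∣ cutX d r i := T.cop_cb.dvd_of_dvd_mul_left ⟨_, h⟩
  have h2 := Int.le_of_dvd (cutX_pos r i T.d_pos) h1
  have := cutX_le r i T.d_pos
  have := T.d_lt_l; have := T.l_lt_a; have := T.a_lt_b; have := T.b_lt_c
  omega

theorem dvd_iff (T : TripleData a b c l q r d) (x y : ℤ) :
    a ∣ b * x + c * y ↔ a ∣ x + l * y := by
  have h : b * x + c * y = b * (x + l * y) + (c - l * b) * y := by ring
  rw [h, dvd_add_left (T.dvd.mul_right y)]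
  exact ⟨fun h => T.cop_ab.dvd_of_dvd_mul_left h, fun h => h.mul_left b⟩

/-- Index `d` is a full period: its point is `(d, q + 1 + a)`, and `b d < c a`. This bounds `N`
below `d`. -/
theorem value_d_neg (T : TripleData a b c l q r d) : b * cutX d r d < c * cutY q d r d := by
  obtain ⟨e1, e2⟩ := T.cut_shift 0 1
  obtain ⟨e3, e4⟩ := @cut_zero q d r
  rw [zero_add, mul_one] at e1 e2
  rw [e1, e2, e3, e4]
  have := T.q_pos; have := T.a_pos; have := T.d_lt_l; have := T.l_lt_a
  have := T.b_lt_c; have := T.b_pos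
  nlinarith

end TripleData

/-! ### Least values that are multiples of `c` -/

/-- `N` is the last index up to which `c y_i < b x_i` holds. -/
structure CutData (a b c l q r d N : ℤ) : Prop extends TripleData a b c l q r d where
  N_nonneg : 0 ≤ N
  pos : ∀ i, 0 ≤ i → i ≤ N → c * cutY q d r i < b * cutX d r i
  neg : b * cutX d r (N + 1) < c * cutY q d r (N + 1)

namespace CutData

variable {a b c l q r d N : ℤ}

theorem N_lt (T : CutData a b c l q r d N) : N < d := by
  by_contra! h
  exact lt_asymm (T.pos d T.d_pos.le h) T.value_d_neg

/-- `c y_i` is the least value `b n₁ + c n₂` in the class of `b x_i`. -/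
theorem le_value (T : CutData a b c l q r d N) {i n₁ n₂ : ℤ} (hi : 0 ≤ i) (hiN : i ≤ N)
    (h₁ : 0 ≤ n₁) (h₂ : 0 ≤ n₂) (h : a ∣ cutX d r i - n₁ - l * n₂) :
    c * cutY q d r i ≤ b * n₁ + c * n₂ := by
  by_contra! hlt
  have hpos := T.pos i hi hiN
  have hb := T.b_pos
  have hc := T.c_pos
  have hx : 0 < cutX d r i - n₁ := by
    have : 0 ≤ c * n₂ := by positivity
    by_contra! hx
    nlinarith
  obtain ⟨j, hj, ex, ey⟩ := T.exists_cut_nonneg h hx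
    (by linarith [cutX_le r i T.d_pos]) h₂
  have hy : cutY q d r j < cutY q d r i := by
    rw [← ey]
    have : 0 ≤ b * n₁ := by positivity
    by_contra! hy
    nlinarith
  have hji : j < i := T.cutY_strictMono.lt_iff_lt.mp hy
  have hle : cutX d r j ≤ cutX d r i := by linarith
  rcases hle.lt_or_eq with hlt' | heq
  -- The point of index `i - j ≤ N` is `(n₁, y_i - n₂)`; its positivity contradicts `hlt`.
  · obtain ⟨e1, e2⟩ := @cut_sub q d r i j T.d_pos hlt'
    have h3 := T.pos (i - j) (by linarith) (by linarith)
    rw [e1, e2] at h3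
    nlinarith
  · obtain ⟨t, ht⟩ := T.shift_of_cutX_eq heq
    have := T.N_lt
    have : t < 0 := by nlinarith [T.d_pos]
    nlinarith [T.d_pos]

/-- A class of `b x` with `0 < x ≤ d` whose least value is a multiple of `c` is that of some
`x_i` with `i ≤ N`. -/
theorem exists_of_minimal (T : CutData a b c l q r d N) {x y : ℤ} (h0 : 0 < x) (h1 : x ≤ d)
    (hy : 0 ≤ y) (h : a ∣ x - l * y)
    (hmin : ∀ n₁ n₂, 0 ≤ n₁ → 0 ≤ n₂ → a ∣ x - n₁ - l * n₂ → c * y ≤ b * n₁ + c * n₂) :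
    ∃ i, 0 ≤ i ∧ i ≤ N ∧ x = cutX d r i := by
  obtain ⟨j, hj, ex, ey⟩ := T.exists_cut_nonneg h h0 h1 hy
  refine ⟨j, hj, ?_, ex⟩
  by_contra! hN
  have hle := hmin x 0 h0.le le_rfl (by simp)
  have hb := T.b_pos
  have hc := T.c_pos
  have hneg := T.neg
  have hposx := cutX_pos r (N + 1) T.d_pos
  have hmono : cutY q d r (N + 1) ≤ cutY q d r j :=
    T.cutY_strictMono.monotone (by linarith)
  -- Trading `y_{N+1}` copies of `c` for `x_{N+1}` copies of `b` lowers the value. If `x` is too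
  -- small for this trade, `b x` itself undercuts `c y`.
  rcases lt_or_ge (cutX d r (N + 1)) x with hlt | hge
  · rw [ex] at hlt
    obtain ⟨e1, e2⟩ := @cut_sub q d r j (N + 1) T.d_pos hlt
    have h3 := hmin (cutX d r (N + 1)) (cutY q d r (j - (N + 1))) hposx.le (by linarith) ?_
    · rw [e2, ← ey] at h3
      nlinarith
    · rw [ex, ← e1]
      exact T.dvd_cut _
  · nlinarith

/-! ### The index of the least `x_i` -/

variable {m : ℤ}

/-- The first `⌊d/u⌋` steps lower `x` from `d` by `u = r % d` each, ending at `d % u < u`; `hN` puts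
that index in range. -/
theorem one_le_min (T : CutData a b c l q r d N) (hu : r % d ≠ 0) (hN : d / (r % d) < N)
    (hm : 0 ≤ m) (hmin : ∀ i, 0 ≤ i → i ≤ N → cutX d r m ≤ cutX d r i) :
    cutX d r m < r % d ∧ 1 ≤ m := by
  have hd := T.d_pos
  have hu0 : 0 < r % d := lt_of_le_of_ne (Int.emod_nonneg r hd.ne') hu.symm
  have hud : r % d < d := Int.emod_lt_of_pos r hd
  set u := r % d with hu_def
  have hr : d * (r / d) + u = r := Int.mul_ediv_add_emod r d
  have hq0 : 0 ≤ d / u := Int.ediv_nonneg hd.le hu0.le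
  have hdm : u * (d / u) + d % u = d := Int.mul_ediv_add_emod d u
  have hmod := Int.emod_nonneg d hu0.ne'
  have hmod' := Int.emod_lt_of_pos d hu0
  -- If `u ∣ d`, coprimality of `d` and `r` forces `u = 1`, so `N > d`, against `N < d`.
  have hne : d % u ≠ 0 := by
    intro h0
    have h1 : u ∣ d := Int.dvd_of_emod_eq_zero h0
    have h2 : u ∣ r := by
      rw [← hr]
      exact dvd_add (h1.mul_right _) dvd_rfl
    have h3 : u ≤ 1 := Int.le_of_dvd one_pos ((T.cop.isUnit_of_dvd' h1 h2).dvd)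
    have h4 : u = 1 := by omega
    rw [h4, Int.ediv_one] at hN
    exact absurd T.N_lt (by omega)
  have key : cutX d r (d / u) = d % u := by
    have e : r * (d / u) / d + 1 = (r / d) * (d / u) + 1 := by
      have hx : d * (r / d * (d / u) + 1) - r * (d / u) = d % u := by
        linear_combination (d / u) * hr - hdm
      apply ediv_eq_of_cut hd <;> rw [hx] <;> omega
    unfold cutX
    rw [e]
    nlinarith
  have hlt : cutX d r m < u := by
    have := hmin (d / u) hq0 hN.le
    omega
  refine ⟨hlt, ?_⟩
  rcases hm.lt_or_eq with h | h
  · omega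
  · rw [← h, (@cut_zero q d r).1] at hlt
    omega

/-- One step subtracts `r % d` modulo `d`, wrapping around when the result would leave the strip. -/
theorem cut_succ (i : ℤ) (hd : 0 < d) (q : ℤ) :
    (cutX d r (i + 1) = cutX d r i - r % d ∧
      cutY q d r (i + 1) = cutY q d r i + (q + 1) * (r / d) + q) ∨
    (cutX d r (i + 1) = cutX d r i + (d - r % d) ∧
      cutY q d r (i + 1) = cutY q d r i + (q + 1) * (r / d + 1) + q) := by
  have hr : d * (r / d) + r % d = r := Int.mul_ediv_add_emod r d
  have hu0 := Int.emod_nonneg r hd.ne'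
  have hud := Int.emod_lt_of_pos r hd
  have h0 := cutX_pos r i hd
  have h1 := cutX_le r i hd
  unfold cutX cutY at *
  rcases lt_or_ge (r % d) (d * (r * i / d + 1) - r * i) with h | h
  · left
    have e : r * (i + 1) / d + 1 = (r * i / d + 1) + r / d := by
      apply ediv_eq_of_cut hd <;> nlinarith
    rw [e]
    constructor
    · linear_combination hr
    · ring
  · right
    have e : r * (i + 1) / d + 1 = (r * i / d + 1) + (r / d + 1) := by
      apply ediv_eq_of_cut hd <;> nlinarith
    rw [e]
    constructor
    · linear_combination hr
    · ring

theorem cut_pred_min (T : CutData a b c l q r d N) (hu : r % d ≠ 0) (hN : d / (r % d) < N)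
    (hm : 0 ≤ m) (hmN : m ≤ N) (hmin : ∀ i, 0 ≤ i → i ≤ N → cutX d r m ≤ cutX d r i) :
    cutX d r (m - 1) = cutX d r m + r % d := by
  obtain ⟨h1, h2⟩ := T.one_le_min hu hN hm hmin
  have hud := Int.emod_lt_of_pos r T.d_pos
  have h3 := hmin (m - 1) (by omega) (by omega)
  have h4 := @cut_succ r d (m - 1) T.d_pos q
  rw [sub_add_cancel] at h4
  omega

/-- A wrapping step adds the point of index `1`, and two positive values cannot sum to a negative
one. -/
theorem cut_last_succ (T : CutData a b c l q r d N) (hN : 1 ≤ N) :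
    cutX d r (N + 1) = cutX d r N - r % d ∧
      cutY q d r (N + 1) = cutY q d r N + (q + 1) * (r / d) + q := by
  refine (@cut_succ r d N T.d_pos q).resolve_right ?_
  rintro ⟨e1, e2⟩
  have h1 := T.pos 1 one_pos.le hN
  have h2 := T.pos N T.N_nonneg le_rfl
  have h3 := T.neg
  have hr : d * (r / d) + r % d = r := Int.mul_ediv_add_emod r d
  have e3 : cutX d r 1 = d - r % d := by
    unfold cutX
    rw [mul_one]
    linarith
  have e4 : cutY q d r 1 = (q + 1) * (r / d + 1) + q := by
    simp [cutY]
  rw [e3, e4] at h1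
  rw [e1, e2] at h3
  linarith

/-- Otherwise the point of index `N + 1` would be the sum of those of indices `m` and `N + 1 - m`,
both of positive value. -/
theorem cut_last_succ_lt (T : CutData a b c l q r d N) (hu : r % d ≠ 0) (hN : d / (r % d) < N)
    (hm : 0 ≤ m) (hmN : m ≤ N) (hmin : ∀ i, 0 ≤ i → i ≤ N → cutX d r m ≤ cutX d r i) :
    cutX d r (N + 1) < cutX d r m := by
  obtain ⟨h1, h2⟩ := T.one_le_min hu hN hm hmin
  have hneg := T.neg
  have hNd := T.N_lt
  by_contra! hle
  rcases hle.lt_or_eq with hlt | heq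
  · obtain ⟨e1, e2⟩ := @cut_sub q d r (N + 1) m T.d_pos hlt
    have h3 := T.pos (N + 1 - m) (by omega) (by omega)
    have h4 := T.pos m hm hmN
    rw [e1, e2] at h3
    linarith
  · obtain ⟨t, ht⟩ := T.shift_of_cutX_eq heq
    have h3 : -1 < t := by nlinarith
    have h4 : t < 0 := by nlinarith
    omega

/-- If `j + m > N`, it exceeds `i` by a positive multiple of `d`, so `y_{j+m} ≥ a`. Then `c y_{j+m}
≥ c a > b x_i`, although the values at `j` and `m` are positive. -/
theorem add_le_of_cutX_eq (T : CutData a b c l q r d N) {i j : ℤ} (hm : 0 ≤ m) (hmN : m ≤ N)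
    (hj : 0 ≤ j) (hjN : j ≤ N) (hi : 0 ≤ i) (hiN : i ≤ N)
    (h : cutX d r j + cutX d r m = cutX d r i) : j + m ≤ N := by
  obtain ⟨e1, e2⟩ := @cut_add q d r j m T.d_pos (h ▸ cutX_le r i T.d_pos)
  have h1 := T.pos j hj hjN
  have h2 := T.pos m hm hmN
  have h3 := T.pos i hi hiN
  obtain ⟨t, ht⟩ := T.shift_of_cutX_eq (e1.trans h)
  have hNd := T.N_lt
  by_contra! hlt
  have ht0 : 0 < t := by nlinarith
  have e3 := (T.cut_shift i t).2
  rw [← ht, e2] at e3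
  have hle := cutX_le r i T.d_pos
  have := T.a_pos; have := T.d_lt_l; have := T.l_lt_a
  have := T.b_lt_c; have := T.b_pos; have hc := T.c_pos
  have hYi : 0 ≤ cutY q d r i := by
    have h5 := T.cutY_strictMono.monotone hi
    rw [(@cut_zero q d r).2] at h5
    have := T.q_pos
    omega
  have h6 : c * a ≤ c * (cutY q d r i + a * t) := by
    apply mul_le_mul_of_nonneg_left _ hc.le
    nlinarith
  have h7 : b * cutX d r i < c * a := by nlinarith
  nlinarith

theorem cut_complement (T : CutData a b c l q r d N) (hu : r % d ≠ 0) (hN : d / (r % d) < N)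
    (hm : 0 ≤ m) (hmin : ∀ i, 0 ≤ i → i ≤ N → cutX d r m ≤ cutX d r i) :
    cutX d r (N - m) + cutX d r m = cutX d r N ∧
      cutY q d r (N - m) + cutY q d r m = cutY q d r N := by
  obtain ⟨h1, h2⟩ := T.one_le_min hu hN hm hmin
  have hu0 := Int.emod_nonneg r T.d_pos.ne'
  have hq0 : 0 ≤ d / (r % d) := Int.ediv_nonneg T.d_pos.le hu0
  have h3 := (T.cut_last_succ (by omega)).1
  have h4 := cutX_pos r (N + 1) T.d_pos
  obtain ⟨e1, e2⟩ := @cut_sub q d r N m T.d_pos (by omega)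
  omega

/-- No lattice point lies in the open rectangle cut out by the two extremal points. -/
theorem not_mem_rectangle (T : CutData a b c l q r d N)
    (hmin : ∀ i, 0 ≤ i → i ≤ N → cutX d r m ≤ cutX d r i) {x y : ℤ}
    (h : a ∣ x - l * y) (hx0 : 0 < x) (hx : x < cutX d r m) (hy0 : 0 ≤ y)
    (hy : y < cutY q d r (N + 1)) : False := by
  have := cutX_le r m T.d_pos
  obtain ⟨i, hi, ex, ey⟩ := T.exists_cut_nonneg h hx0 (by omega) hy0
  rw [ey] at hy
  have h1 := T.cutY_strictMono.lt_iff_lt.mp hy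
  have h2 := hmin i hi (by omega)
  omega

end CutData

/-! ### The L-shape and the Frobenius number -/

/-- The L-shaped set of pairs representing the least values of the residue classes. -/
def InShape (d r q N m i j : ℤ) : Prop :=
  0 ≤ i ∧ 0 ≤ j ∧ i < cutX d r m ∧ j < cutY q d r (N + 1) ∧
    (i < cutX d r m - cutX d r (N + 1) ∨ j < cutY q d r (N + 1) - cutY q d r m)

/-- The hypotheses under which index `m` attains the least `x_i`. -/
structure MinData (a b c l q r d N m : ℤ) : Prop extends CutData a b c l q r d N where
  m_nonneg : 0 ≤ m
  m_le : m ≤ N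
  le : ∀ i, 0 ≤ i → i ≤ N → cutX d r m ≤ cutX d r i
  lt : cutX d r (N + 1) < cutX d r m

namespace MinData

variable {a b c l q r d N m : ℤ}

theorem cutY_min_pos (T : MinData a b c l q r d N m) : 0 < cutY q d r m := by
  have h5 := T.cutY_strictMono.monotone T.m_nonneg
  rw [(@cut_zero q d r).2] at h5
  have := T.q_pos
  omega

theorem cutY_min_lt (T : MinData a b c l q r d N m) : cutY q d r m < cutY q d r (N + 1) :=
  T.cutY_strictMono (by linarith [T.m_le])

theorem d_lt_a (T : MinData a b c l q r d N m) : d < a := T.d_lt_l.trans T.l_lt_a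

/-- If `y > 0`, combining `(x, y)` with the point of index `N + 1` or `m`, depending on the arm of
the L, lands in the empty rectangle. -/
theorem eq_zero_of_inShape (T : MinData a b c l q r d N m) {x y : ℤ} (h : a ∣ x + l * y)
    (hs : InShape d r q N m x y) : x = 0 ∧ y = 0 := by
  obtain ⟨hx0, hy0, hx, hy, hor⟩ := hs
  have hP := T.cutY_min_pos
  have hP' := T.cutY_min_lt
  have hs' := cutX_pos r (N + 1) T.d_pos
  have hlt := T.lt
  have hd := cutX_le r m T.d_pos
  have hda := T.d_lt_a
  rcases hy0.lt_or_eq with hy1 | rfl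
  · exfalso
    by_cases hc : x < cutX d r m - cutX d r (N + 1)
    · refine T.not_mem_rectangle (m := m) T.le (x := x + cutX d r (N + 1))
        (y := cutY q d r (N + 1) - y) ?_ (by omega) (by omega) (by omega) (by omega)
      have := dvd_add h (T.dvd_cut (N + 1))
      exact this.trans (dvd_of_eq (by ring))
    · refine T.not_mem_rectangle (m := m) T.le (x := cutX d r m - x)
        (y := cutY q d r m + y) ?_ (by omega) (by omega) (by omega) (by omega)
      have := dvd_sub (T.dvd_cut m) h
      exact this.trans (dvd_of_eq (by ring))
  · refine ⟨?_, rfl⟩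
    rw [mul_zero, add_zero] at h
    exact Int.eq_zero_of_dvd_of_nonneg_of_lt hx0 (by omega) h

theorem inShape_mono {i j i' j' : ℤ} (h : InShape d r q N m i j) (hi : 0 ≤ i') (hj : 0 ≤ j')
    (hii : i' ≤ i) (hjj : j' ≤ j) : InShape d r q N m i' j' := by
  unfold InShape at *
  omega

/-- The shape is closed downwards, so a difference with coordinates of equal sign stays in it; one
with opposite signs gives a point of the empty rectangle. -/
theorem inShape_inj (T : MinData a b c l q r d N m) {i j i' j' : ℤ}
    (h : InShape d r q N m i j) (h' : InShape d r q N m i' j')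
    (hdvd : a ∣ (i - i') + l * (j - j')) : i = i' ∧ j = j' := by
  wlog hii : i' ≤ i generalizing i j i' j'
  · have := this h' h (by rw [← dvd_neg]; exact hdvd.trans (dvd_of_eq (by ring))) (by omega)
    omega
  rcases le_or_gt j' j with hjj | hjj
  · have := T.eq_zero_of_inShape hdvd (inShape_mono h (by omega) (by omega)
      (by linarith [h'.1]) (by linarith [h'.2.1]))
    omega
  · rcases hii.lt_or_eq with hlt | rfl
    · exfalso
      obtain ⟨h1, h2, h3, h4, -⟩ := h
      obtain ⟨h1', h2', h3', h4', -⟩ := h'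
      exact T.not_mem_rectangle (m := m) T.le (x := i - i') (y := j' - j)
        (by exact hdvd.trans (dvd_of_eq (by ring))) (by omega) (by omega) (by omega) (by omega)
    · have := T.eq_zero_of_inShape (x := i' - i') (y := j' - j)
        (by rw [← dvd_neg]; exact hdvd.trans (dvd_of_eq (by ring)))
        (inShape_mono h' (by omega) (by omega) (by linarith [h'.1]) (by linarith [h.2.1]))
      omega

/-- Every pair can be moved into the L-shape without increasing its value. -/
theorem exists_inShape (T : MinData a b c l q r d N m) (n₁ n₂ : ℤ) (h₁ : 0 ≤ n₁) (h₂ : 0 ≤ n₂) :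
    ∃ i j, InShape d r q N m i j ∧ a ∣ (n₁ - i) + l * (n₂ - j) ∧
      b * i + c * j ≤ b * n₁ + c * n₂ := by
  obtain ⟨k, hk⟩ : ∃ k : ℕ, (k : ℤ) = b * n₁ + c * n₂ := by
    refine ⟨(b * n₁ + c * n₂).toNat, Int.toNat_of_nonneg ?_⟩
    have := T.b_pos
    have := T.c_pos
    positivity
  induction k using Nat.strong_induction_on generalizing n₁ n₂ with
  | _ k ih =>
  have hP := T.cutY_min_pos
  have hP' := T.cutY_min_lt
  have hs' := cutX_pos r (N + 1) T.d_pos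
  have hlt := T.lt
  have hV := T.pos m T.m_nonneg T.m_le
  have hW := T.neg
  -- Descent on the value: any class-preserving move of negative value that stays in the quadrant
  -- suffices.
  have step : ∀ u v : ℤ, 0 ≤ n₁ + u → 0 ≤ n₂ + v → b * u + c * v < 0 → a ∣ u + l * v →
      ∃ i j, InShape d r q N m i j ∧ a ∣ (n₁ - i) + l * (n₂ - j) ∧
        b * i + c * j ≤ b * n₁ + c * n₂ := by
    intro u v hu hv hneg hdvd
    have h0 : 0 ≤ b * (n₁ + u) + c * (n₂ + v) := by
      have := T.b_pos
      have := T.c_pos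
      positivity
    have hcast := Int.toNat_of_nonneg h0
    obtain ⟨i, j, hs, hd, hle⟩ :=
      ih (b * (n₁ + u) + c * (n₂ + v)).toNat (by zify; rw [hcast]; linarith) _ _ hu hv hcast
    refine ⟨i, j, hs, ?_, by linarith⟩
    have := dvd_sub hd hdvd
    exact this.trans (dvd_of_eq (by ring))
  have dV := T.dvd_cut m
  have dW := T.dvd_cut (N + 1)
  by_cases c1 : n₁ < cutX d r m
  · by_cases c2 : n₂ < cutY q d r (N + 1)
    · by_cases c3 : n₁ < cutX d r m - cutX d r (N + 1) ∨
        n₂ < cutY q d r (N + 1) - cutY q d r m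
      · exact ⟨n₁, n₂, ⟨h₁, h₂, c1, c2, c3⟩, by simp, le_rfl⟩
      · push Not at c3
        refine step (cutX d r (N + 1) - cutX d r m) (cutY q d r m - cutY q d r (N + 1))
          (by omega) (by omega) (by linarith) ?_
        have := dvd_sub dW dV
        exact this.trans (dvd_of_eq (by ring))
    · refine step (cutX d r (N + 1)) (-cutY q d r (N + 1))
          (by omega) (by omega) (by linarith) ?_
      exact dW.trans (dvd_of_eq (by ring))
  · refine step (-cutX d r m) (cutY q d r m) (by omega) (by omega) (by linarith) ?_
    rw [← dvd_neg]
    exact dV.trans (dvd_of_eq (by ring))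

/-- The largest value in the L-shape. -/
def corner (b c d r q N m : ℤ) : ℤ :=
  max (b * (cutX d r m - 1) + c * (cutY q d r (N + 1) - cutY q d r m - 1))
    (b * (cutX d r m - cutX d r (N + 1) - 1) + c * (cutY q d r (N + 1) - 1))

theorem value_le_corner (T : MinData a b c l q r d N m) {i j : ℤ}
    (h : InShape d r q N m i j) : b * i + c * j ≤ corner b c d r q N m := by
  obtain ⟨h1, h2, h3, h4, h5⟩ := h
  have hb := T.b_pos
  have hc := T.c_pos
  rcases h5 with h5 | h5
  · refine le_max_of_le_right (add_le_add ?_ ?_) <;>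
      exact mul_le_mul_of_nonneg_left (by omega) (by omega)
  · refine le_max_of_le_left (add_le_add ?_ ?_) <;>
      exact mul_le_mul_of_nonneg_left (by omega) (by omega)

theorem exists_corner (T : MinData a b c l q r d N m) :
    ∃ i j, InShape d r q N m i j ∧ corner b c d r q N m = b * i + c * j := by
  have hP := T.cutY_min_pos
  have hP' := T.cutY_min_lt
  have hs' := cutX_pos r (N + 1) T.d_pos
  have hlt := T.lt
  rcases max_choice (b * (cutX d r m - 1) + c * (cutY q d r (N + 1) - cutY q d r m - 1))
    (b * (cutX d r m - cutX d r (N + 1) - 1) + c * (cutY q d r (N + 1) - 1)) with h | h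
  · exact ⟨_, _, by unfold InShape; omega, h⟩
  · exact ⟨_, _, by unfold InShape; omega, h⟩

theorem a_le_corner (T : MinData a b c l q r d N m) : a ≤ corner b c d r q N m := by
  have hP := T.cutY_min_pos
  have hP' := T.cutY_min_lt
  have hs' := cutX_pos r (N + 1) T.d_pos
  have hlt := T.lt
  have h := T.value_le_corner (i := 1) (j := 0) (by unfold InShape; omega)
  have := T.a_lt_b
  omega

/-- The corner is the only shape point of its class, so no pair in that class has a smaller value.
-/
theorem not_representable (T : MinData a b c l q r d N m) (n₀ n₁ n₂ : ℤ) (h₀ : 0 ≤ n₀)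
    (h₁ : 0 ≤ n₁) (h₂ : 0 ≤ n₂) :
    corner b c d r q N m - a ≠ a * n₀ + b * n₁ + c * n₂ := by
  intro h
  obtain ⟨i, j, hs, hv⟩ := T.exists_corner
  obtain ⟨i', j', hs', hd, hle⟩ := T.exists_inShape n₁ n₂ h₁ h₂
  have h1 : a ∣ (i - n₁) + l * (j - n₂) := by
    rw [← T.dvd_iff]
    exact ⟨n₀ + 1, by linarith⟩
  have h2 : a ∣ (i - i') + l * (j - j') := by
    have := dvd_add h1 hd
    exact this.trans (dvd_of_eq (by ring))
  obtain ⟨rfl, rfl⟩ := T.inShape_inj hs hs' h2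
  have := T.a_pos
  nlinarith

theorem representable (T : MinData a b c l q r d N m) {n : ℤ}
    (h : corner b c d r q N m - a < n) :
    ∃ n₀ n₁ n₂ : ℤ, 0 ≤ n₀ ∧ 0 ≤ n₁ ∧ 0 ≤ n₂ ∧ n = a * n₀ + b * n₁ + c * n₂ := by
  obtain ⟨u, v, huv⟩ := T.cop_ab
  -- As `v b ≡ 1` modulo `a`, taking `v n % a` copies of `b` reaches the class of `n`.
  obtain ⟨i, j, hs, hd, -⟩ := T.exists_inShape ((v * n) % a) 0
    (Int.emod_nonneg _ T.a_pos.ne') le_rfl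
  rw [← T.dvd_iff] at hd
  have h1 : a ∣ n - b * ((v * n) % a) := by
    have := Int.mul_ediv_add_emod (v * n) a
    exact ⟨u * n + b * (v * n / a), by linear_combination (-n) * huv - b * this⟩
  have h2 : a ∣ n - (b * i + c * j) := by
    have := dvd_add h1 hd
    exact this.trans (dvd_of_eq (by ring))
  obtain ⟨t, ht⟩ := h2
  have hle := T.value_le_corner hs
  refine ⟨t, i, j, ?_, hs.1, hs.2.1, by linarith⟩
  have : -1 < t := by nlinarith [T.a_pos]
  omega

end MinData

/-! ### Transfer from the natural-number definitions -/

theorem tripleData_of_cond {a b c : ℕ} (hab : a < b) (hbc : b < c) (ha : 2 ≤ a)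
    (hcop_ab : Nat.Coprime a b) (hcop_ac : Nat.Coprime a c) (hcop_bc : Nat.Coprime b c)
    (hl : 0 < ellVal a b c) (hu : uBar a b c ≠ 0) :
    TripleData (a : ℤ) b c (ellVal a b c) (qBar a b c) (rBar a b c) (dBar a b c) := by
  have : NeZero a := ⟨by omega⟩
  have hrl := rBar_lt_ellVal a b c hl
  have hla : ellVal a b c < a := ZMod.val_lt _
  have hra := rBar_add a b c
  have hdl : dBar a b c + rBar a b c = ellVal a b c := Nat.sub_add_cancel hrl.le
  have hdvd : (a : ℤ) ∣ c - ellVal a b c * b := by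
    rw [← ZMod.intCast_zmod_eq_zero_iff_dvd]
    push_cast
    rw [ellVal, ZMod.natCast_zmod_val, mul_assoc, mul_comm (_⁻¹),
      ZMod.coe_mul_inv_eq_one b hcop_ab.symm, mul_one, sub_self]
  have hcop : IsCoprime (a : ℤ) c := Nat.isCoprime_iff_coprime.mpr hcop_ac
  zify at hra hdl
  exact
    { d_pos := by
        have : 0 < dBar a b c := Nat.sub_pos_of_lt hrl
        exact_mod_cast this
      r_pos := by
        have : rBar a b c ≠ 0 := fun h => hu (by rw [uBar, h, Nat.zero_mod])
        omega
      q_pos := by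
        have : 0 < qBar a b c := Nat.div_pos hla.le hl
        omega
      l_eq := hdl.symm
      a_eq := by linarith
      -- A common divisor of `d` and `r` divides `l` and `a`, hence `c = l b + k a`, but `a` and `c`
      -- are coprime.
      cop := by
        obtain ⟨s, t, h⟩ := hcop
        obtain ⟨k, hk⟩ := hdvd
        refine ⟨(s + t * k) * qBar a b c + t * b, (s + t * k) * (qBar a b c + 1) + t * b, ?_⟩
        linear_combination h - t * hk + (s + t * k) * hra + (t * b + (s + t * k) * qBar a b c) * hdl
      a_lt_b := by exact_mod_cast hab
      b_lt_c := by exact_mod_cast hbc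
      cop_ab := Nat.isCoprime_iff_coprime.mpr hcop_ab
      cop_cb := (Nat.isCoprime_iff_coprime.mpr hcop_bc).symm
      dvd := hdvd }

theorem cast_xSeq {a b c : ℕ} (hl : 0 < ellVal a b c) (i : ℕ) :
    (xSeq a b c i : ℤ) = cutX (dBar a b c) (rBar a b c) i := by
  have h := xSeq_add a b c i hl
  zify at h
  unfold cutX
  linarith

theorem cast_ySeq (a b c i : ℕ) :
    (ySeq a b c i : ℤ) = cutY (qBar a b c) (dBar a b c) (rBar a b c) i := by
  unfold ySeq cutY
  push_cast
  rfl

theorem floor_div_intCast (n : ℤ) {A : ℤ} (hA : 0 ≤ A) : ⌊(n : ℚ) / (A : ℚ)⌋ = n / A := by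
  lift A to ℕ using hA
  exact_mod_cast Rat.floor_intCast_div_natCast n A

namespace TripleData

variable {a b c l q r d : ℤ}

/-- With `s = ⌊r i / d⌋`, the value at `i` is `(s + 1) Ā - i B̄`. Since `s ≤ ⌊i B̄ / Ā⌋` always
holds, equality means exactly that this is positive. -/
theorem floor_eq_iff_value_lt (T : TripleData a b c l q r d) {i : ℤ} (hi : 0 ≤ i)
    (hA : 0 < b * d - c * (q + 1)) :
    i * (b * r + c * q) / (b * d - c * (q + 1)) = i * r / d ↔
      c * cutY q d r i < b * cutX d r i := by
  have hd := T.d_pos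
  have hv : b * cutX d r i - c * cutY q d r i =
      (r * i / d + 1) * (b * d - c * (q + 1)) - i * (b * r + c * q) := by
    unfold cutX cutY
    ring
  rw [mul_comm i r]
  set s := r * i / d
  have hs : d * s ≤ r * i := Int.mul_ediv_self_le hd.ne'
  have hs0 : 0 ≤ s := Int.ediv_nonneg (mul_nonneg T.r_pos.le hi) hd.le
  have hle : s ≤ i * (b * r + c * q) / (b * d - c * (q + 1)) := by
    rw [Int.le_ediv_iff_mul_le hA]
    have hc := T.c_pos
    have hb := T.b_pos
    have hq := T.q_pos
    have h1 : s * (b * d) ≤ i * (b * r) := by nlinarith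
    have h2 : 0 ≤ s * (c * (q + 1)) := by positivity
    have h3 : 0 ≤ i * (c * q) := by positivity
    linarith
  have hlt : i * (b * r + c * q) / (b * d - c * (q + 1)) < s + 1 ↔
      c * cutY q d r i < b * cutX d r i := by
    rw [Int.ediv_lt_iff_lt_mul hA]
    constructor <;> intro h <;> linarith
  rw [← hlt]
  omega

end TripleData

theorem cutData_of_cond {a b c : ℕ}
    (T : TripleData (a : ℤ) b c (ellVal a b c) (qBar a b c) (rBar a b c) (dBar a b c))
    (hmu : 0 < muBar a b c) :
    CutData (a : ℤ) b c (ellVal a b c) (qBar a b c) (rBar a b c) (dBar a b c)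
      (muBar a b c) := by
  have hd := T.d_pos
  set S := {i : ℕ | ⌊((i : ℚ) + 1) * (BBar a b c : ℚ) / (ABar a b c : ℚ)⌋ ≠
    ⌊((i : ℚ) + 1) * (rBar a b c : ℚ) / (dBar a b c : ℚ)⌋} with hS
  have hfloor : ∀ i : ℕ, ⌊((i : ℚ) + 1) * (rBar a b c : ℚ) / (dBar a b c : ℚ)⌋ =
      ((i : ℤ) + 1) * rBar a b c / dBar a b c := by
    intro i
    have := floor_div_intCast (((i : ℤ) + 1) * rBar a b c) hd.le
    push_cast at this
    exact this
  have hv0 := T.value_ne 0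
  rw [(@cut_zero (qBar a b c) (dBar a b c) (rBar a b c)).1,
    (@cut_zero (qBar a b c) (dBar a b c) (rBar a b c)).2] at hv0
  have hB : 0 < BBar a b c := by
    have := T.b_pos; have := T.c_pos; have := T.r_pos; have := T.q_pos
    unfold BBar
    positivity
  -- `Ā = 0` would be a tie at index `0`; `Ā < 0` makes the first floor negative at once, so `μ̄ =
  -- 0`.
  have hA : 0 < ABar a b c := by
    by_contra! hA
    have hA : ABar a b c < 0 := lt_of_le_of_ne hA (sub_ne_zero.mpr hv0)
    have h0 : 0 ∈ S := by
      have h1 : ⌊(((0 : ℕ) : ℚ) + 1) * (BBar a b c : ℚ) / (ABar a b c : ℚ)⌋ < 0 := by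
        rw [Int.floor_lt]
        push_cast
        rw [zero_add, one_mul]
        exact div_neg_of_pos_of_neg (by exact_mod_cast hB) (by exact_mod_cast hA)
      have h2 : 0 ≤ ⌊(((0 : ℕ) : ℚ) + 1) * (rBar a b c : ℚ) / (dBar a b c : ℚ)⌋ :=
        Int.floor_nonneg.mpr (by positivity)
      exact (h1.trans_le h2).ne
    have : muBar a b c ≤ 0 := Nat.sInf_le h0
    omega
  have hmem : ∀ i : ℕ, i ∉ S ↔
      (c : ℤ) * cutY (qBar a b c) (dBar a b c) (rBar a b c) (i + 1) <
        b * cutX (dBar a b c) (rBar a b c) (i + 1) := by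
    intro i
    rw [← T.floor_eq_iff_value_lt (i := (i : ℤ) + 1) (by omega) hA, ← hfloor, hS,
      Set.mem_ofPred_eq, not_not]
    have := floor_div_intCast (((i : ℤ) + 1) * BBar a b c) hA.le
    push_cast at this
    rw [this]
    rfl
  -- Without a member, `sInf` would be the default `0`. The shift by one in `μ̄` turns index `d`
  -- into `d - 1`.
  have hne : S.Nonempty := by
    refine ⟨dBar a b c - 1, ?_⟩
    by_contra h
    rw [hmem] at h
    have e : ((dBar a b c - 1 : ℕ) : ℤ) + 1 = dBar a b c := by omega
    rw [e] at h
    exact lt_asymm h T.value_d_neg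
  have hmuS : muBar a b c ∈ S := Nat.sInf_mem hne
  refine { T with N_nonneg := by omega, pos := ?_, neg := ?_ }
  · intro i hi hiN
    lift i to ℕ using hi
    rcases i with _ | i
    · rw [Nat.cast_zero, (@cut_zero (qBar a b c) (dBar a b c) (rBar a b c)).1,
        (@cut_zero (qBar a b c) (dBar a b c) (rBar a b c)).2]
      have hA' := hA
      unfold ABar at hA'
      linarith
    · have hi : i ∉ S := Nat.notMem_of_lt_sInf (show i < muBar a b c by omega)
      rw [hmem] at hi
      exact_mod_cast hi
  · refine lt_of_le_of_ne ?_ (T.value_ne _)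
    by_contra! h
    exact (hmem _).mpr h hmuS

theorem mMin_le {a b c x z : ℕ} (hz : 0 < z) (h : ∃ n₁ n₂ : ℕ, z = b * n₁ + c * n₂)
    (hx : z ≡ x [MOD a]) : mMin a b c x ≤ z :=
  Nat.sInf_le ⟨hz, h, hx⟩

theorem mMin_spec {a b c x z : ℕ} (hz : 0 < z) (h : ∃ n₁ n₂ : ℕ, z = b * n₁ + c * n₂)
    (hx : z ≡ x [MOD a]) : 0 < mMin a b c x ∧
      (∃ n₁ n₂ : ℕ, mMin a b c x = b * n₁ + c * n₂) ∧ mMin a b c x ≡ x [MOD a] := by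
  have : z ∈ {z : ℕ | 0 < z ∧ (∃ n₁ n₂ : ℕ, z = b * n₁ + c * n₂) ∧ z ≡ x [MOD a]} := ⟨hz, h, hx⟩
  exact Nat.sInf_mem ⟨z, this⟩

theorem XBar_eq {a b c : ℕ} (hl : 0 < ellVal a b c)
    (T : CutData (a : ℤ) b c (ellVal a b c) (qBar a b c) (rBar a b c) (dBar a b c)
      (muBar a b c)) (hcop : Nat.Coprime a c) :
    XBar a b c = {x : ℕ | ∃ i : ℕ, i ≤ muBar a b c ∧ x = xSeq a b c i} := by
  have ha := T.a_pos
  have hb := T.b_pos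
  have hc := T.c_pos
  have hab := T.a_lt_b
  have hbc := T.b_lt_c
  have hda := T.d_lt_l.trans T.l_lt_a
  ext x
  constructor
  · rintro ⟨hxd, hmod⟩
    obtain ⟨y, hy⟩ := Nat.modEq_zero_iff_dvd.mp hmod
    -- For `x = 0`, a positive multiple of both `a` and `c` is at least `a c`, but `a b` is a
    -- smaller candidate.
    rcases Nat.eq_zero_or_pos x with rfl | hx
    · exfalso
      have h0 : a * b ≡ b * 0 [MOD a] := by
        rw [mul_zero]
        exact Nat.modEq_zero_iff_dvd.mpr (dvd_mul_right a b)
      have hpos : 0 < a * b := by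
        apply Nat.mul_pos <;> omega
      have hrep : ∃ n₁ n₂ : ℕ, a * b = b * n₁ + c * n₂ := ⟨a, 0, by ring⟩
      have hle := mMin_le hpos hrep h0
      obtain ⟨h1, -, h3⟩ := mMin_spec hpos hrep h0
      rw [hy] at h1 h3 hle
      have h4 : a ∣ y := hcop.dvd_of_dvd_mul_left (Nat.modEq_zero_iff_dvd.mp h3)
      have h5 : a ≤ y := Nat.le_of_dvd (Nat.pos_of_mul_pos_left h1) h4
      have : (b : ℤ) * a < c * a := by nlinarith
      zify at h5 hle
      nlinarith
    · have hpos : 0 < b * x := Nat.mul_pos (by omega) hx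
      obtain ⟨h1, -, h3⟩ := mMin_spec (a := a) (c := c) hpos ⟨x, 0, by ring⟩ rfl
      rw [hy] at h1 h3
      obtain ⟨i, hi, hiN, hxi⟩ := T.exists_of_minimal (x := x) (y := y) (by omega) (by omega)
        (by omega) (by
          have := (Nat.modEq_iff_dvd.mp h3)
          push_cast at this
          have h4 := (T.dvd_iff x (-y)).mp (by exact this.trans (dvd_of_eq (by ring)))
          exact h4.trans (dvd_of_eq (by ring))) (by
          intro n₁ n₂ hn₁ hn₂ hdvd
          lift n₁ to ℕ using hn₁
          lift n₂ to ℕ using hn₂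
          have hm : mMin a b c (b * x) ≤ b * n₁ + c * n₂ := by
            refine mMin_le ?_ ⟨n₁, n₂, rfl⟩ ?_
            -- The zero combination, excluded by positivity in `mMin`, would give `a ∣ x` with `0 <
            -- x ≤ d < a`.
            · by_contra! h0
              have h5 : n₁ = 0 ∧ n₂ = 0 := by
                constructor <;> by_contra h6
                · have := Nat.mul_pos (show 0 < b by omega) (Nat.pos_of_ne_zero h6)
                  omega
                · have := Nat.mul_pos (show 0 < c by omega) (Nat.pos_of_ne_zero h6)
                  omega
              obtain ⟨rfl, rfl⟩ := h5
              simp only [Nat.cast_zero, sub_zero, mul_zero] at hdvd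
              have := Int.le_of_dvd (by omega) hdvd
              omega
            · rw [Nat.modEq_iff_dvd]
              have := (T.dvd_iff (x - n₁) (-n₂)).mpr (by exact hdvd.trans (dvd_of_eq (by ring)))
              push_cast
              exact this.trans (dvd_of_eq (by ring))
          rw [hy] at hm
          exact_mod_cast hm)
      lift i to ℕ using hi
      refine ⟨i, by omega, ?_⟩
      have := cast_xSeq hl i
      omega
  · rintro ⟨i, hi, rfl⟩
    have hX := cast_xSeq hl i
    have hY := cast_ySeq a b c i
    have hXle := cutX_le (rBar a b c) i T.d_pos
    have hXpos := cutX_pos (rBar a b c) i T.d_pos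
    rw [← hX] at hXle hXpos
    refine ⟨by omega, ?_⟩
    have hyp : 0 < ySeq a b c i := by unfold ySeq; positivity
    have hcy : c * ySeq a b c i ≡ b * xSeq a b c i [MOD a] := by
      rw [Nat.modEq_iff_dvd]
      have h := T.dvd_cut i
      rw [← hX, ← hY] at h
      have := (T.dvd_iff (xSeq a b c i) (-ySeq a b c i)).mpr (h.trans (dvd_of_eq (by ring)))
      push_cast
      exact this.trans (dvd_of_eq (by ring))
    have hpos : 0 < c * ySeq a b c i := Nat.mul_pos (by omega) hyp
    have hle := mMin_le (b := b) hpos ⟨0, ySeq a b c i, by ring⟩ hcy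
    obtain ⟨-, ⟨n₁, n₂, h2⟩, h3⟩ := mMin_spec (b := b) hpos ⟨0, ySeq a b c i, by ring⟩ hcy
    have hge := T.le_value (i := i) (n₁ := n₁) (n₂ := n₂) (by omega) (by omega) (by omega)
      (by omega) (by
        rw [h2, Nat.modEq_iff_dvd] at h3
        push_cast at h3
        rw [← hX]
        have := (T.dvd_iff (xSeq a b c i - n₁) (-n₂)).mp (h3.trans (dvd_of_eq (by ring)))
        exact this.trans (dvd_of_eq (by ring)))
    rw [← hY] at hge
    have heq : mMin a b c (b * xSeq a b c i) = c * ySeq a b c i := by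
      apply le_antisymm hle
      rw [h2]
      exact_mod_cast hge
    rw [heq]
    exact Nat.modEq_zero_iff_dvd.mpr (dvd_mul_right _ _)

theorem mem_closure_triple {a b c n : ℕ} : n ∈ AddSubmonoid.closure ({a, b, c} : Set ℕ) ↔
    ∃ n₀ n₁ n₂ : ℕ, n = a * n₀ + b * n₁ + c * n₂ := by
  constructor
  · intro h
    induction h using AddSubmonoid.closure_induction with
    | mem x hx =>
      rcases hx with rfl | rfl | rfl
      · exact ⟨1, 0, 0, by ring⟩
      · exact ⟨0, 1, 0, by ring⟩
      · exact ⟨0, 0, 1, by ring⟩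
    | zero => exact ⟨0, 0, 0, by ring⟩
    | add x y _ _ hx hy =>
      obtain ⟨x₀, x₁, x₂, rfl⟩ := hx
      obtain ⟨y₀, y₁, y₂, rfl⟩ := hy
      exact ⟨x₀ + y₀, x₁ + y₁, x₂ + y₂, by ring⟩
  · rintro ⟨n₀, n₁, n₂, rfl⟩
    have mem : ∀ z ∈ ({a, b, c} : Set ℕ), ∀ k : ℕ, z * k ∈ AddSubmonoid.closure {a, b, c} := by
      intro z hz k
      rw [mul_comm, ← smul_eq_mul]
      exact nsmul_mem (AddSubmonoid.subset_closure hz) k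
    exact add_mem (add_mem (mem a (by simp) _) (mem b (by simp) _)) (mem c (by simp) _)

theorem MinData.frobeniusNumber {a b c : ℕ} {l q r d N m : ℤ}
    (T : MinData (a : ℤ) b c l q r d N m) :
    ∃ g : ℕ, FrobeniusNumber g {a, b, c} ∧ (g : ℤ) + a = corner b c d r q N m := by
  have hg : (((corner b c d r q N m - a).toNat : ℕ) : ℤ) = corner b c d r q N m - a :=
    Int.toNat_of_nonneg (sub_nonneg.mpr T.a_le_corner)
  refine ⟨(corner b c d r q N m - a).toNat, ⟨?_, ?_⟩, by omega⟩
  · rw [Set.mem_ofPred_eq, mem_closure_triple]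
    rintro ⟨n₀, n₁, n₂, h⟩
    zify at h
    rw [hg] at h
    exact T.not_representable n₀ n₁ n₂ (by omega) (by omega) (by omega) h
  · intro k hk
    by_contra! hlt
    refine hk (mem_closure_triple.mpr ?_)
    obtain ⟨n₀, n₁, n₂, h₀, h₁, h₂, h⟩ := T.representable (n := k) (by omega)
    lift n₀ to ℕ using h₀
    lift n₁ to ℕ using h₁
    lift n₂ to ℕ using h₂
    exact ⟨n₀, n₁, n₂, by exact_mod_cast h⟩

theorem theorem6 (a b c : ℕ) (ha : 2 ≤ a) (hab : a < b) (hbc : b < c)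
    (hcop_ab : Nat.Coprime a b) (hcop_ac : Nat.Coprime a c) (hcop_bc : Nat.Coprime b c)
    (hkl : kVal b c < ellVal a b c)
    (hu : uBar a b c ≠ 0)
    (hmu : muBar a b c > dBar a b c / uBar a b c) :
    XBar a b c = {x : ℕ | ∃ i : ℕ, i ≤ muBar a b c ∧ x = xSeq a b c i} ∧
    (∃ m : ℕ, m ≤ muBar a b c ∧ IsLeast (XBar a b c) (xSeq a b c m)) ∧
    ∀ m : ℕ, m ≤ muBar a b c → IsLeast (XBar a b c) (xSeq a b c m) →
      1 ≤ m ∧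
      ∃ w : ℕ,
        IsGreatest {j : ℕ | j ≤ muBar a b c ∧ xSeq a b c j + xSeq a b c m ∈ XBar a b c} w ∧
        ∃ g : ℕ, FrobeniusNumber g {a, b, c} ∧
          (g : ℤ) + a =
            max ((b : ℤ) * (xSeq a b c m - 1) + c * ySeq a b c w)
              ((b : ℤ) * ((xSeq a b c (m - 1) : ℤ) - xSeq a b c (muBar a b c) - 1)
                + c * ySeq a b c (muBar a b c))
            + (c : ℤ) * (((qBar a b c : ℤ) + 1) * (((ellVal a b c - 1) / dBar a b c : ℕ) : ℤ) - 2) := by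
  have hl : 0 < ellVal a b c := by omega
  have T₀ := tripleData_of_cond hab hbc ha hcop_ab hcop_ac hcop_bc hl hu
  have T := cutData_of_cond T₀ ((Nat.zero_le _).trans_lt hmu)
  have hX := XBar_eq hl T hcop_ac
  have hd := T.d_pos
  have hu' : (rBar a b c : ℤ) % dBar a b c ≠ 0 := by exact_mod_cast hu
  have hmu' : (dBar a b c : ℤ) / (rBar a b c % dBar a b c) < muBar a b c := by exact_mod_cast hmu
  have hmem : ∀ i ≤ muBar a b c, xSeq a b c i ∈ XBar a b c := fun i hi => by
    rw [hX]
    exact ⟨i, hi, rfl⟩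
  refine ⟨hX, ?_, ?_⟩
  · have hne : (XBar a b c).Nonempty := ⟨_, hmem 0 (Nat.zero_le _)⟩
    have hs := Nat.sInf_mem hne
    have hs' := hs
    rw [hX] at hs'
    obtain ⟨m, hm, hxm⟩ := hs'
    refine ⟨m, hm, hxm ▸ hX ▸ hs, ?_⟩
    rw [← hX] at hxm
    intro z hz
    exact hxm ▸ Nat.sInf_le hz
  · intro m hm hleast
    have hle : ∀ i : ℤ, 0 ≤ i → i ≤ muBar a b c →
        cutX (dBar a b c) (rBar a b c) m ≤ cutX (dBar a b c) (rBar a b c) i := by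
      intro i hi hiN
      lift i to ℕ using hi
      rw [← cast_xSeq hl, ← cast_xSeq hl]
      exact_mod_cast hleast.2 (hmem i (by omega))
    have hm0 : (0 : ℤ) ≤ m := by omega
    have hmN : (m : ℤ) ≤ muBar a b c := by omega
    obtain ⟨hmu_lt, hm1⟩ := T.one_le_min hu' hmu' hm0 hle
    have hlt := T.cut_last_succ_lt hu' hmu' hm0 hmN hle
    obtain ⟨hcX, hcY⟩ := T.cut_complement hu' hmu' hm0 hle
    obtain ⟨hsX, hsY⟩ := T.cut_last_succ (by omega)
    have hpred := T.cut_pred_min hu' hmu' hm0 hmN hle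
    have hsub : ((muBar a b c - m : ℕ) : ℤ) = muBar a b c - m := Nat.cast_sub hm
    have hsub1 : ((m - 1 : ℕ) : ℤ) = m - 1 := by omega
    have Tm : MinData (a : ℤ) b c (ellVal a b c) (qBar a b c) (rBar a b c) (dBar a b c)
        (muBar a b c) m := { T with m_nonneg := hm0, m_le := hmN, le := hle, lt := hlt }
    refine ⟨by omega, muBar a b c - m, ⟨⟨Nat.sub_le _ _, ?_⟩, ?_⟩, ?_⟩
    · have h : xSeq a b c (muBar a b c - m) + xSeq a b c m = xSeq a b c (muBar a b c) := by
        zify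
        rw [cast_xSeq hl, cast_xSeq hl, cast_xSeq hl, hsub]
        exact hcX
      rw [h]
      exact hmem _ le_rfl
    · rintro j ⟨hj, hjX⟩
      rw [hX] at hjX
      obtain ⟨i, hi, hxi⟩ := hjX
      zify at hxi
      rw [cast_xSeq hl, cast_xSeq hl, cast_xSeq hl] at hxi
      have := T.add_le_of_cutX_eq hm0 hmN (j := j) (i := i) (by omega) (by omega) (by omega)
        (by omega) hxi
      omega
    · obtain ⟨g, hg, hga⟩ := Tm.frobeniusNumber
      refine ⟨g, hg, ?_⟩
      -- Here `l - 1 = d + (r - 1)`, and `d ∤ r` gives `⌊(r - 1)/d⌋ = ⌊r/d⌋`.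
      have hfl : (((ellVal a b c - 1) / dBar a b c : ℕ) : ℤ) = (rBar a b c : ℤ) / dBar a b c + 1 := by
        have h1 := Int.mul_ediv_add_emod (rBar a b c : ℤ) (dBar a b c)
        have h2 := Int.emod_nonneg (rBar a b c : ℤ) hd.ne'
        have h3 := Int.emod_lt_of_pos (rBar a b c : ℤ) hd
        have h4 := T.l_eq
        push_cast [Nat.cast_sub (show 1 ≤ ellVal a b c by omega)]
        rw [Int.ediv_eq_iff_of_pos hd]
        constructor <;> linarith [show (1 : ℤ) ≤ rBar a b c % dBar a b c by omega]
      rw [hga, hfl, MinData.corner, ← max_add_add_right, cast_xSeq hl, cast_xSeq hl, cast_xSeq hl,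
        cast_ySeq, cast_ySeq, hsub, hsub1, hpred, hsX, hsY, ← hcY]
      congr 1 <;> ring
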